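/- Consider the Tower of Hanoi with 3 pegs and $n \ge 0$ disks of distinct sizes. A state is a distribution of the disks over the pegs in which the sizes on each peg decrease from bottom to top; there are $3^n$ states. A move transfers the top disk of one peg to the top of another peg, provided that the result is again a state. A random move is chosen uniformly from the moves that are possible in the current state, given the past. Let $E_{r\to a}(n)$ be the expected number of random moves, starting from a state chosen uniformly from the $3^n$ states, until all disks first lie on the same (any) peg; no move is counted if this already holds at the start, so that $E_{r\to a}(0)=0$. Then, for every integer $n\ge 0$, $$E_{r\to a}(n) = \frac{5^n-2\cdot 3^n+1}{4}.$$ This is the formula conjectured by Henry Bottomley for the sequence A007798 in the On-Line Encyclopedia of Integer Sequences. -/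

import Mathlib

open MeasureTheory ProbabilityTheory
open scoped ENNReal

noncomputable section

namespace Hanoi

/-- A valid state with `n` disks: disk `d : Fin n` lies on peg `s d`. Disks are numbered by
increasing size, and the order of the disks on each peg is forced by their sizes. -/
abbrev State (n : ℕ) : Type := Fin n → Fin 3

/-- The disk `m.1` may be moved to the peg `m.2` in the state `s`: the target is another peg,
no smaller disk lies on the peg of `m.1` (it is a top disk), and no smaller disk lies on the
target peg (the result is a valid state). -/
def IsValidMove {n : ℕ} (s : State n) (m : Fin n × Fin 3) : Prop :=
  m.2 ≠ s m.1 ∧ (∀ e : Fin n, e < m.1 → s e ≠ s m.1) ∧ (∀ e : Fin n, e < m.1 → s e ≠ m.2)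

/-- The state after moving the disk `m.1` to the peg `m.2`. -/
def applyMove {n : ℕ} (s : State n) (m : Fin n × Fin 3) : State n :=
  Function.update s m.1 m.2

open Classical in
/-- The valid moves in the state `s`. -/
def validMoves {n : ℕ} (s : State n) : Finset (Fin n × Fin 3) :=
  Finset.univ.filter (IsValidMove s)

open Classical in
/-- The law of the state after one random move from `s`, chosen uniformly among the valid moves.
If there is no valid move (which happens only for `n = 0`), the state does not change. -/
def randomMove {n : ℕ} (s : State n) : PMF (State n) :=
  if h : (validMoves s).Nonempty then (PMF.uniformOfFinset (validMoves s) h).map (applyMove s)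
  else PMF.pure s

/-- The one-step transition kernel of the random walk on states. -/
def stepKernel (n : ℕ) : Kernel (State n) (State n) :=
  Kernel.ofFunOfCountable fun s => (randomMove s).toMeasure

instance (n : ℕ) : IsMarkovKernel (stepKernel n) :=
  ⟨fun s => by
    change IsProbabilityMeasure (randomMove s).toMeasure
    infer_instance⟩

/-- The transition kernel at time `t`: given the history of states up to time `t`, make a random
move from the current state. -/
def historyKernel (n t : ℕ) : Kernel (Finset.Iic t → State n) (State n) :=
  (stepKernel n).comap (fun h => h ⟨t, Finset.mem_Iic.2 le_rfl⟩) (measurable_pi_apply _)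

instance (n t : ℕ) : IsMarkovKernel (historyKernel n t) := by
  unfold historyKernel
  infer_instance

/-- The law of the sequence of states (indexed by the number of moves made) when the starting
state is uniform among all `3 ^ n` states and all moves are random. -/
def walkLaw (n : ℕ) : Measure (ℕ → State n) :=
  Kernel.trajMeasure (X := fun _ => State n) (PMF.uniformOfFintype (State n)).toMeasure
    (historyKernel n)

/-- All disks lie on the same (any) peg. -/
def OnOnePeg {n : ℕ} (s : State n) : Prop := ∃ p : Fin 3, ∀ d : Fin n, s d = p

/-- The number of moves made until all disks first lie on one peg (`0` if they do at the start,
`∞` if this never happens). -/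
def solvingTime {n : ℕ} (ω : ℕ → State n) : ℝ≥0∞ :=
  ⨅ (t : ℕ) (_ : OnOnePeg (ω t)), (t : ℝ≥0∞)

/-- The expected number of random moves, from a uniformly random state, until all disks first lie
on one peg. -/
def expectedMoves (n : ℕ) : ℝ≥0∞ := ∫⁻ ω, solvingTime ω ∂(walkLaw n)

end Hanoi

end

noncomputable section

namespace Hanoi

open Filter Topology Preorder

/-! For states with N ≥ 1 disks, prescribe values `a` at the three one-peg corners and let `payoff`
solve f = 1 + average of f over the neighbours elsewhere. Non-corner states have degree 3, so this
is an electrical network with current 3 injected at each of them. Fixing the largest disk splits the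
graph into three copies of the previous one, joined by three edges. Seen from its corners, each copy
is a triangle of equal resistances plus a constant current (`totalDrop_payoff_const`), so the corner
values solve a small linear system. Passing from N to N + 1 disks adds 5^N - 3^N to the mean of
`payoff`, and summation gives the formula (`sum_payoff`). `expectedMoves_eq_of_firstStep` identifies
this mean for `a = 0` with the expected time. -/

/-- The peg that is neither `i` nor `k`, for `i ≠ k`. -/
def thirdPeg (i k : Fin 3) : Fin 3 := -(i + k)

@[simp] lemma thirdPeg_zero_one : thirdPeg 0 1 = 2 := rfl
@[simp] lemma thirdPeg_one_zero : thirdPeg 1 0 = 2 := rfl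
@[simp] lemma thirdPeg_zero_two : thirdPeg 0 2 = 1 := rfl
@[simp] lemma thirdPeg_two_zero : thirdPeg 2 0 = 1 := rfl
@[simp] lemma thirdPeg_one_two : thirdPeg 1 2 = 0 := rfl
@[simp] lemma thirdPeg_two_one : thirdPeg 2 1 = 0 := rfl

/-! ### Moves after adding a largest disk -/

lemma isValidMove_snoc_castSucc {n : ℕ} (s : State n) (i : Fin 3) (d : Fin n) (p : Fin 3) :
    IsValidMove (Fin.snoc s i : State (n + 1)) (d.castSucc, p) ↔ IsValidMove s (d, p) := by
  simp only [IsValidMove, Fin.forall_fin_succ', Fin.castSucc_lt_castSucc_iff, Fin.snoc_castSucc,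
    Fin.snoc_last, (Fin.castSucc_lt_last d).not_gt, false_imp_iff, and_true]

lemma isValidMove_snoc_last {n : ℕ} (s : State n) (i p : Fin 3) :
    IsValidMove (Fin.snoc s i : State (n + 1)) (Fin.last n, p) ↔
      p ≠ i ∧ ∀ e, s e = thirdPeg i p := by
  have key : ∀ i p x : Fin 3, p ≠ i → ((x ≠ i ∧ x ≠ p) ↔ x = thirdPeg i p) := by
    unfold thirdPeg; decide
  simp only [IsValidMove, Fin.forall_fin_succ', Fin.castSucc_lt_last, Fin.snoc_castSucc,
    Fin.snoc_last, lt_irrefl, false_imp_iff, and_true, true_imp_iff]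
  refine and_congr_right fun hp => ?_
  rw [← forall_and]
  exact forall_congr' fun e => key i p (s e) hp

lemma applyMove_snoc_castSucc {n : ℕ} (s : State n) (i : Fin 3) (d : Fin n) (p : Fin 3) :
    applyMove (Fin.snoc s i : State (n + 1)) (d.castSucc, p) =
      Fin.snoc (applyMove s (d, p)) i := by
  simp [applyMove]

lemma applyMove_snoc_last {n : ℕ} (s : State n) (i p : Fin 3) :
    applyMove (Fin.snoc s i : State (n + 1)) (Fin.last n, p) = Fin.snoc s p := by
  simp only [applyMove, Fin.update_snoc_last]

lemma sum_validMoves_snoc {n : ℕ} (s : State n) (i : Fin 3) (F : Fin (n + 1) × Fin 3 → ℝ) :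
    ∑ m ∈ validMoves (Fin.snoc s i : State (n + 1)), F m =
      ∑ m ∈ validMoves s, F (m.1.castSucc, m.2) +
        ∑ p : Fin 3, if p ≠ i ∧ ∀ e, s e = thirdPeg i p then F (Fin.last n, p) else 0 := by
  classical
  simp only [validMoves, Finset.sum_filter, Fintype.sum_prod_type, Fin.sum_univ_castSucc,
    isValidMove_snoc_castSucc, isValidMove_snoc_last]

lemma sum_validMoves_snoc_of_not_onOnePeg {n : ℕ} {s : State n} (hs : ¬ OnOnePeg s) (i : Fin 3)
    (F : Fin (n + 1) × Fin 3 → ℝ) :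
    ∑ m ∈ validMoves (Fin.snoc s i : State (n + 1)), F m =
      ∑ m ∈ validMoves s, F (m.1.castSucc, m.2) := by
  rw [sum_validMoves_snoc, add_eq_left]
  exact Finset.sum_eq_zero fun p _ => if_neg fun h => hs ⟨_, h.2⟩

/-- With at least one smaller disk, all of them on `k`, the largest disk can go only to the peg
avoiding both `i` and `k`. -/
lemma sum_validMoves_snoc_const {n : ℕ} (i k : Fin 3) (F : Fin (n + 2) × Fin 3 → ℝ) :
    ∑ m ∈ validMoves (Fin.snoc (fun _ => k : State (n + 1)) i : State (n + 2)), F m =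
      ∑ m ∈ validMoves (fun _ => k : State (n + 1)), F (m.1.castSucc, m.2) +
        if k = i then 0 else F (Fin.last (n + 1), thirdPeg i k) := by
  rw [sum_validMoves_snoc]
  congr 1
  have key : ∀ i k p : Fin 3, (p ≠ i ∧ k = thirdPeg i p) ↔ (k ≠ i ∧ p = thirdPeg i k) := by
    unfold thirdPeg; decide
  simp only [forall_const, key]
  by_cases h : k = i <;> simp [h]

/-- The sum of the drops of `f` over the moves that are possible in the state `s`. -/
def totalDrop {n : ℕ} (f : State n → ℝ) (s : State n) : ℝ :=
  ∑ m ∈ validMoves s, (f s - f (applyMove s m))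

lemma totalDrop_snoc_of_not_onOnePeg {n : ℕ} (f : State (n + 1) → ℝ) {s : State n}
    (hs : ¬ OnOnePeg s) (i : Fin 3) :
    totalDrop f (Fin.snoc s i) = totalDrop (fun t => f (Fin.snoc t i)) s := by
  simp only [totalDrop, sum_validMoves_snoc_of_not_onOnePeg hs, applyMove_snoc_castSucc]

lemma totalDrop_snoc_const {n : ℕ} (f : State (n + 2) → ℝ) (i k : Fin 3) :
    totalDrop f (Fin.snoc (fun _ => k : State (n + 1)) i) =
      totalDrop (fun t => f (Fin.snoc t i)) (fun _ => k) +
        if k = i then 0 else f (Fin.snoc (fun _ => k : State (n + 1)) i) -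
          f (Fin.snoc (fun _ => k : State (n + 1)) (thirdPeg i k)) := by
  simp only [totalDrop, sum_validMoves_snoc_const, applyMove_snoc_castSucc, applyMove_snoc_last]

lemma onOnePeg_snoc_const_iff {n : ℕ} (i k : Fin 3) :
    OnOnePeg (Fin.snoc (fun _ => k : State (n + 1)) i : State (n + 2)) ↔ k = i := by
  simp only [OnOnePeg, Fin.forall_fin_succ' (n := n + 1), Fin.snoc_castSucc, Fin.snoc_last,
    forall_const]
  constructor
  · rintro ⟨p, h, h'⟩; rw [h, h']
  · rintro rfl; exact ⟨k, rfl, rfl⟩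

lemma snoc_const_self {n : ℕ} (k : Fin 3) :
    (Fin.snoc (fun _ => k : State n) k : State (n + 1)) = fun _ => k := by
  funext d
  refine Fin.lastCases ?_ (fun d => ?_) d <;> simp

lemma card_validMoves_const {n : ℕ} (k : Fin 3) :
    ((validMoves (fun _ => k : State (n + 1))).card : ℝ) = 2 := by
  -- Writing the count as a sum of ones makes the decompositions of sums over moves applicable.
  have h1 : ∀ n, ∀ s : State n, ((validMoves s).card : ℝ) = ∑ m ∈ validMoves s, 1 := by simp
  induction n with
  | zero =>
    rw [h1, ← snoc_const_self, sum_validMoves_snoc]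
    have : validMoves (fun _ => k : State 0) = ∅ := by
      ext ⟨d, p⟩; exact d.elim0
    rw [this]
    fin_cases k <;> simp [Fin.sum_univ_three] <;> norm_num
  | succ n ih => rw [h1, ← snoc_const_self, sum_validMoves_snoc_const, ← h1]; simpa using ih

lemma card_validMoves {n : ℕ} {s : State (n + 1)} (hs : ¬ OnOnePeg s) :
    ((validMoves s).card : ℝ) = 3 := by
  have h1 : ∀ n, ∀ s : State n, ((validMoves s).card : ℝ) = ∑ m ∈ validMoves s, 1 := by simp
  induction n with
  | zero => exact absurd ⟨s 0, fun d => congrArg s (Fin.fin_one_eq_zero d)⟩ hs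
  | succ n ih =>
    induction s using Fin.snocCases with | snoc t i => ?_
    by_cases ht : OnOnePeg t
    · obtain ⟨k, hk⟩ := ht
      obtain rfl : t = fun _ => k := funext hk
      rw [onOnePeg_snoc_const_iff] at hs
      rw [h1, sum_validMoves_snoc_const, ← h1, card_validMoves_const, if_neg hs]
      norm_num
    · rw [h1, sum_validMoves_snoc_of_not_onOnePeg ht, ← h1, ih ht]

/-! ### The network reduction -/

/-- The resistance of each edge of the triangle that is equivalent to the graph of states with
`n + 1` disks as seen from its three corners. -/
def resistance : ℕ → ℝ
  | 0 => 1
  | n + 1 => (5 * resistance n + 3) / 3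

lemma resistance_eq (n : ℕ) : resistance n = 3 * ((5 / 3) ^ (n + 1) - 1) / 2 := by
  induction n with
  | zero => norm_num [resistance]
  | succ n ih => rw [resistance, ih]; ring

lemma resistance_pos (n : ℕ) : 0 < resistance n := by
  induction n with
  | zero => norm_num [resistance]
  | succ n ih => rw [resistance]; positivity

/-- The values at the corners of the subgraph where the disk `n + 1` lies on peg `i`, given the
values `a` at the corners of the graph of states with `n + 2` disks. -/
def cornerValues (n : ℕ) (a : Fin 3 → ℝ) (i k : Fin 3) : ℝ :=
  if k = i then a i else
    ((2 * resistance n + 3) * a i + resistance n * a k + 2 * resistance n * a (thirdPeg i k)) /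
      (5 * resistance n + 3) + 3 ^ (n + 1) * resistance n

/-- The expected payoff of the random walk on the states with `n + 1` disks that is stopped when
all disks lie on one peg `i`, with a payoff of `1` for each move and a final payoff `a i`. -/
def payoff : (n : ℕ) → (Fin 3 → ℝ) → State (n + 1) → ℝ
  | 0, a, s => a (s 0)
  | n + 1, a, s => payoff n (cornerValues n a (s (Fin.last _))) (Fin.init s)

lemma payoff_snoc {n : ℕ} (a : Fin 3 → ℝ) (s : State (n + 1)) (i : Fin 3) :
    payoff (n + 1) a (Fin.snoc s i) = payoff n (cornerValues n a i) s := by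
  rw [payoff, Fin.snoc_last, Fin.init_snoc]

lemma payoff_const (n : ℕ) (a : Fin 3 → ℝ) (k : Fin 3) : payoff n a (fun _ => k) = a k := by
  induction n generalizing a with
  | zero => rfl
  | succ n ih => rw [← snoc_const_self, payoff_snoc, ih, cornerValues, if_pos rfl]

lemma payoff_nonneg (n : ℕ) {a : Fin 3 → ℝ} (ha : ∀ k, 0 ≤ a k) (s : State (n + 1)) :
    0 ≤ payoff n a s := by
  induction n generalizing a with
  | zero => exact ha _
  | succ n ih =>
    refine ih (fun k => ?_) _
    have := resistance_pos n
    have h1 := ha (s (Fin.last _))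
    have h2 := ha k
    have h3 := ha (thirdPeg (s (Fin.last _)) k)
    unfold cornerValues
    split_ifs <;> positivity

/-- This is the current leaving a corner. The first term is the response of the equivalent triangle;
the second is the share, one third by symmetry, of the current 3 injected at each of the 3^(n+1) - 3
other states. -/
lemma totalDrop_payoff_const (n : ℕ) (a : Fin 3 → ℝ) (k : Fin 3) :
    totalDrop (payoff n a) (fun _ => k) =
      (3 * a k - ∑ i, a i) / resistance n - (3 ^ (n + 1) - 3) := by
  induction n generalizing a with
  | zero =>
    have : validMoves (fun _ => k : State 0) = ∅ := by
      ext ⟨d, p⟩; exact d.elim0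
    rw [totalDrop, ← snoc_const_self, sum_validMoves_snoc, this]
    simp only [applyMove_snoc_last]
    fin_cases k <;> simp [payoff, Fin.sum_univ_three, resistance, Fin.snoc] <;> ring
  | succ n ih =>
    rw [← snoc_const_self, totalDrop_snoc_const, if_pos rfl, add_zero]
    simp only [payoff_snoc]
    rw [ih, resistance]
    have := (resistance_pos n)
    fin_cases k <;> simp [Fin.sum_univ_three, cornerValues] <;> field_simp <;> ring

/-- Inside a copy this is induction. At an end of a connecting edge, the corner current of the copy
and the current along the edge must add up to 3, which is the system that `cornerValues` solves. -/
lemma totalDrop_payoff (n : ℕ) (a : Fin 3 → ℝ) {s : State (n + 1)} (hs : ¬ OnOnePeg s) :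
    totalDrop (payoff n a) s = 3 := by
  induction n generalizing a with
  | zero => exact absurd ⟨s 0, fun d => congrArg s (Fin.fin_one_eq_zero d)⟩ hs
  | succ n ih =>
    induction s using Fin.snocCases with | snoc t i => ?_
    by_cases ht : OnOnePeg t
    · obtain ⟨k, hk⟩ := ht
      obtain rfl : t = fun _ => k := funext hk
      rw [onOnePeg_snoc_const_iff] at hs
      rw [totalDrop_snoc_const, if_neg hs]
      simp only [payoff_snoc, totalDrop_payoff_const, payoff_const]
      have := (resistance_pos n)
      fin_cases k <;> fin_cases i <;>
        first
        | exact absurd rfl hs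
        | (simp [Fin.sum_univ_three, cornerValues]; field_simp; ring)
    · rw [totalDrop_snoc_of_not_onOnePeg _ ht]
      simp only [payoff_snoc]
      exact ih _ ht

lemma sum_payoff (n : ℕ) (a : Fin 3 → ℝ) :
    ∑ s, payoff n a s =
      3 ^ (n + 1) * ((∑ i, a i) / 3 + (5 ^ (n + 1) - 2 * 3 ^ (n + 1) + 1) / 4) := by
  induction n generalizing a with
  | zero =>
    rw [← (Equiv.funUnique (Fin 1) (Fin 3)).symm.sum_comp]
    simp [payoff, Equiv.funUnique]; norm_num; ring
  | succ n ih =>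
    rw [← (Fin.snocEquiv (fun _ : Fin (n + 2) => Fin 3)).sum_comp, Fintype.sum_prod_type]
    have : ∀ i : Fin 3, ∑ t : State (n + 1), payoff (n + 1) a
        (Fin.snocEquiv (fun _ : Fin (n + 2) => Fin 3) (i, t)) =
        ∑ t, payoff n (cornerValues n a i) t := fun i =>
      Finset.sum_congr rfl fun t _ => payoff_snoc a t i
    simp only [this, ih]
    have := (resistance_pos n)
    -- Two of the three corners of each copy carry this constant, so it raises the mean by 5^(n+1) -
    -- 3^(n+1).
    have h : 3 ^ (n + 1) * resistance n = 3 * (5 ^ (n + 1) - 3 ^ (n + 1)) / 2 := by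
      rw [resistance_eq, div_pow]; field_simp
    simp [Fin.sum_univ_three, cornerValues, h]
    field_simp
    ring

/-! ### From first-step equations to the expected time -/

open Classical in
/-- The indicator of the event that the disks do not lie on one peg at any time up to `k`. -/
def unsolvedUpTo {n : ℕ} (k : ℕ) (ω : ℕ → State n) : ℝ≥0∞ :=
  if ∀ i ≤ k, ¬ OnOnePeg (ω i) then 1 else 0

lemma solvingTime_eq_tsum {n : ℕ} (ω : ℕ → State n) :
    solvingTime ω = ∑' k, unsolvedUpTo k ω := by
  classical
  by_cases h : ∃ t, OnOnePeg (ω t)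
  · have h1 : ∀ k, unsolvedUpTo k ω = if k < Nat.find h then 1 else 0 := fun k => by
      simp only [unsolvedUpTo, Nat.lt_find_iff]
    rw [tsum_eq_sum (s := Finset.range (Nat.find h))]
    · rw [Finset.sum_congr rfl fun k hk => (h1 k).trans (if_pos (Finset.mem_range.1 hk))]
      simp only [Finset.sum_const, Finset.card_range, nsmul_eq_mul, mul_one]
      refine le_antisymm (iInf₂_le (Nat.find h) (Nat.find_spec h)) (le_iInf₂ fun t ht => ?_)
      exact_mod_cast Nat.find_le ht
    · intro k hk
      rw [h1, if_neg (by simpa using hk)]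
  · have h' : ∀ t, ¬ OnOnePeg (ω t) := fun t ht => h ⟨t, ht⟩
    simp [solvingTime, unsolvedUpTo, h']

instance (n : ℕ) : IsProbabilityMeasure (walkLaw n) := by
  unfold walkLaw
  infer_instance

open Classical in
lemma unsolvedUpTo_eq_frestrictLe {n : ℕ} (k : ℕ) (ω : ℕ → State n) :
    unsolvedUpTo k ω =
      if ∀ i, ¬ OnOnePeg (frestrictLe (π := fun _ => State n) k ω i) then 1 else 0 := by
  have : (∀ i ≤ k, ¬ OnOnePeg (ω i)) ↔
      ∀ i, ¬ OnOnePeg (frestrictLe (π := fun _ => State n) k ω i) :=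
    ⟨fun h i => h i (Finset.mem_Iic.1 i.2), fun h i hi => h ⟨i, Finset.mem_Iic.2 hi⟩⟩
  simp only [unsolvedUpTo, this]

lemma measurable_unsolvedUpTo (n k : ℕ) :
    Measurable (unsolvedUpTo k : (ℕ → State n) → ℝ≥0∞) := by
  classical
  have : Measurable fun h : Finset.Iic k → State n =>
      if ∀ i, ¬ OnOnePeg (h i) then (1 : ℝ≥0∞) else 0 := .of_discrete
  have h := this.comp (measurable_frestrictLe (X := fun _ => State n) k)
  exact (funext (unsolvedUpTo_eq_frestrictLe (n := n) k)) ▸ h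

/-- The Markov property: `unsolvedUpTo k` depends only on the history up to time `k`, and the joint
law of this history and the next state is a composition product. -/
lemma lintegral_unsolvedUpTo_mul_succ (n k : ℕ) (g : State n → ℝ≥0∞) :
    ∫⁻ ω, unsolvedUpTo k ω * g (ω (k + 1)) ∂walkLaw n =
      ∫⁻ ω, unsolvedUpTo k ω * ∫⁻ s, g s ∂stepKernel n (ω k) ∂walkLaw n := by
  classical
  let G : (Finset.Iic k → State n) → ℝ≥0∞ := fun h => if ∀ i, ¬ OnOnePeg (h i) then 1 else 0
  have hG : ∀ ω : ℕ → State n, unsolvedUpTo k ω = G (frestrictLe (π := fun _ => State n) k ω) :=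
    unsolvedUpTo_eq_frestrictLe k
  have hF : Measurable fun p : (Finset.Iic k → State n) × State n => G p.1 * g p.2 :=
    .of_discrete
  have key := Kernel.map_frestrictLe_trajMeasure_compProd_eq_map_trajMeasure
    (X := fun _ => State n) (κ := historyKernel n)
    (μ₀ := (PMF.uniformOfFintype (State n)).toMeasure) (a := k)
  have key2 := congrArg (fun μ => ∫⁻ p, G p.1 * g p.2 ∂μ) key
  rw [Measure.lintegral_compProd hF, lintegral_map hF (by fun_prop),
    lintegral_map .of_discrete (by fun_prop)] at key2
  simp only [hG]
  refine key2.symm.trans (lintegral_congr fun ω => ?_)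
  have h : historyKernel n k (frestrictLe (π := fun _ => State n) k ω) = stepKernel n (ω k) := rfl
  rw [h]
  exact lintegral_const_mul (G (frestrictLe (π := fun _ => State n) k ω))
    (Measurable.of_discrete (f := g))

lemma lintegral_walkLaw_zero (n : ℕ) (g : State n → ℝ≥0∞) :
    ∫⁻ ω, g (ω 0) ∂walkLaw n = ∫⁻ s, g s ∂(PMF.uniformOfFintype (State n)).toMeasure := by
  have h1 : (walkLaw n).map (frestrictLe (π := fun _ => State n) 0) =
      (PMF.uniformOfFintype (State n)).toMeasure.map
        (MeasurableEquiv.piUnique (fun _ : Finset.Iic 0 => State n)).symm := by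
    rw [walkLaw, Kernel.trajMeasure, Measure.map_comp _ _ (by fun_prop),
      Kernel.traj_map_frestrictLe, Kernel.partialTraj_self, Measure.id_comp]
  have h2 := congrArg (fun μ => ∫⁻ h, g (h ⟨0, by simp⟩) ∂μ) h1
  rw [lintegral_map .of_discrete (by fun_prop), lintegral_map .of_discrete (by fun_prop)] at h2
  exact h2

/-- A bounded solution of the first-step equations gives the expected solving time. -/
lemma expectedMoves_eq_of_firstStep (n : ℕ) (f : State n → ℝ≥0∞) (hf : ∀ s, f s ≠ ∞)
    (h0 : ∀ s, OnOnePeg s → f s = 0)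
    (h1 : ∀ s, ¬ OnOnePeg s → f s = 1 + ∫⁻ t, f t ∂stepKernel n s) :
    expectedMoves n = ∫⁻ s, f s ∂(PMF.uniformOfFintype (State n)).toMeasure := by
  classical
  set P : ℕ → ℝ≥0∞ := fun k => ∫⁻ ω, unsolvedUpTo k ω ∂walkLaw n with hP
  set M : ℕ → ℝ≥0∞ := fun k => ∫⁻ ω, unsolvedUpTo k ω * f (ω k) ∂walkLaw n
  have hstep : ∀ k, M k = P k + M (k + 1) := by
    intro k
    -- Since `f` vanishes at solved states, the condition at time `k + 1` may be dropped.
    have e1 : M (k + 1) = ∫⁻ ω, unsolvedUpTo k ω * f (ω (k + 1)) ∂walkLaw n := by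
      refine lintegral_congr fun ω => ?_
      by_cases h : OnOnePeg (ω (k + 1))
      · simp [h0 _ h]
      · simp only [unsolvedUpTo, Nat.le_succ_iff, or_imp, forall_and, forall_eq, h,
          not_false_eq_true, and_true, Nat.succ_eq_add_one]
    rw [e1, lintegral_unsolvedUpTo_mul_succ, hP, ← lintegral_add_left (measurable_unsolvedUpTo n k)]
    refine lintegral_congr fun ω => ?_
    by_cases h : ∀ i ≤ k, ¬ OnOnePeg (ω i)
    · simp only [unsolvedUpTo, if_pos h, one_mul, h1 _ (h k le_rfl)]
    · simp only [unsolvedUpTo, if_neg h, zero_mul, add_zero]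
  have hzero : M 0 = ∫⁻ s, f s ∂(PMF.uniformOfFintype (State n)).toMeasure := by
    rw [← lintegral_walkLaw_zero]
    refine lintegral_congr fun ω => ?_
    by_cases h : OnOnePeg (ω 0) <;> simp [unsolvedUpTo, h, h0]
  have hsum : ∀ N, M 0 = ∑ k ∈ Finset.range N, P k + M N := by
    intro N
    induction N with
    | zero => simp
    | succ N ih => rw [ih, Finset.sum_range_succ, hstep N, add_assoc]
  -- This bound makes the remainder `M N` vanish: `P` is summable because its partial sums stay
  -- below the finite `M 0`, so `P N` tends to 0.
  have hle : ∀ N, M N ≤ (∑ s, f s) * P N := by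
    intro N
    rw [hP, ← lintegral_const_mul _ (measurable_unsolvedUpTo n N)]
    refine lintegral_mono fun ω => ?_
    rw [mul_comm]
    gcongr
    exact Finset.single_le_sum (f := f) (fun _ _ => zero_le) (Finset.mem_univ (ω N))
  have hC : ∑ s, f s ≠ ∞ := ENNReal.sum_ne_top.2 fun s _ => hf s
  have hM0 : M 0 ≠ ∞ := by
    refine ne_top_of_le_ne_top hC ((hle 0).trans ?_)
    refine mul_le_of_le_one_right zero_le ?_
    calc P 0 ≤ ∫⁻ _, 1 ∂walkLaw n := lintegral_mono fun ω => by
          unfold unsolvedUpTo; split_ifs <;> simp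
      _ = 1 := by simp
  have hPsum : ∑' k, P k ≠ ∞ := by
    refine ne_top_of_le_ne_top hM0 (ENNReal.tsum_le_of_sum_range_le fun N => ?_)
    rw [hsum N]
    exact le_self_add
  have hPlim : Tendsto P atTop (𝓝 0) := ENNReal.tendsto_atTop_zero_of_tsum_ne_top hPsum
  have hMlim : Tendsto M atTop (𝓝 0) := by
    refine tendsto_of_tendsto_of_tendsto_of_le_of_le tendsto_const_nhds ?_ (fun _ => zero_le) hle
    simpa using ENNReal.Tendsto.const_mul hPlim (Or.inr hC)
  have hlim : Tendsto (fun N => ∑ k ∈ Finset.range N, P k + M N) atTop (𝓝 (∑' k, P k + 0)) :=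
    (ENNReal.tendsto_nat_tsum P).add hMlim
  simp only [← hsum, add_zero] at hlim
  rw [← hzero, tendsto_nhds_unique tendsto_const_nhds hlim, expectedMoves,
    ← lintegral_tsum fun k => (measurable_unsolvedUpTo n k).aemeasurable]
  exact lintegral_congr solvingTime_eq_tsum

lemma lintegral_stepKernel {n : ℕ} {s : State (n + 1)} (hs : ¬ OnOnePeg s)
    (g : State (n + 1) → ℝ) (hg : ∀ t, 0 ≤ g t) :
    ∫⁻ t, ENNReal.ofReal (g t) ∂stepKernel (n + 1) s =
      ENNReal.ofReal ((∑ m ∈ validMoves s, g (applyMove s m)) / 3) := by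
  have hc : (validMoves s).card = 3 := by exact_mod_cast card_validMoves hs
  have hne : (validMoves s).Nonempty := Finset.card_pos.1 (by omega)
  have h1 : stepKernel (n + 1) s = (randomMove s).toMeasure := rfl
  rw [h1, randomMove, dif_pos hne, ← PMF.toMeasure_map _ _ .of_discrete,
    lintegral_map .of_discrete .of_discrete, lintegral_fintype]
  simp only [PMF.toMeasure_apply_singleton _ _ (measurableSet_singleton _),
    PMF.uniformOfFinset_apply, mul_ite, mul_zero, Finset.sum_ite_mem, Finset.univ_inter, hc]
  rw [← Finset.sum_mul, ← ENNReal.ofReal_sum_of_nonneg fun m _ => hg _,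
    ENNReal.ofReal_div_of_pos (by norm_num), div_eq_mul_inv]
  simp

lemma lintegral_uniformOfFintype {n : ℕ} (g : State n → ℝ) (hg : ∀ t, 0 ≤ g t) :
    ∫⁻ s, ENNReal.ofReal (g s) ∂(PMF.uniformOfFintype (State n)).toMeasure =
      ENNReal.ofReal ((∑ s, g s) / 3 ^ n) := by
  rw [lintegral_fintype]
  simp only [PMF.toMeasure_apply_singleton _ _ (measurableSet_singleton _),
    PMF.uniformOfFintype_apply]
  rw [← Finset.sum_mul, ← ENNReal.ofReal_sum_of_nonneg fun m _ => hg _,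
    ENNReal.ofReal_div_of_pos (by positivity), div_eq_mul_inv]
  simp [ENNReal.ofReal_pow]

lemma expectedMoves_zero : expectedMoves 0 = 0 := by
  rw [expectedMoves_eq_of_firstStep 0 0 (by simp) (by simp)]
  · simp
  · exact fun s hs => absurd ⟨0, fun d => d.elim0⟩ hs

lemma expectedMoves_succ (n : ℕ) :
    expectedMoves (n + 1) =
      ENNReal.ofReal (((5 : ℝ) ^ (n + 1) - 2 * 3 ^ (n + 1) + 1) / 4) := by
  have hnn : ∀ s, 0 ≤ payoff n 0 s := payoff_nonneg n fun _ => le_rfl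
  rw [expectedMoves_eq_of_firstStep (n + 1) (fun s => ENNReal.ofReal (payoff n 0 s))
    (fun s => ENNReal.ofReal_ne_top), lintegral_uniformOfFintype _ hnn, sum_payoff]
  · congr 1
    field_simp
    simp
  · rintro s ⟨p, hp⟩
    obtain rfl : s = fun _ => p := funext hp
    simp [payoff_const]
  · intro s hs
    rw [lintegral_stepKernel hs _ hnn, ← ENNReal.ofReal_one,
      ← ENNReal.ofReal_add zero_le_one
        (div_nonneg (Finset.sum_nonneg fun m _ => hnn _) (by norm_num))]
    congr 1
    -- Dividing the drop equation by the degree 3 gives the first-step equation.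
    have h := totalDrop_payoff n 0 hs
    rw [totalDrop, Finset.sum_sub_distrib, Finset.sum_const, nsmul_eq_mul,
      card_validMoves hs] at h
    linarith

end Hanoi

end

theorem mainTheorem2 (n : ℕ) :
    Hanoi.expectedMoves n = ENNReal.ofReal (((5 : ℝ) ^ n - 2 * 3 ^ n + 1) / 4) := by
  cases n with
  | zero => rw [Hanoi.expectedMoves_zero]; norm_num
  | succ n => exact Hanoi.expectedMoves_succ n
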